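/- **Theorem (Omitting types).** We work in first-order logic for metric structures, with a single domain of quantification and with all relation symbols, including the metric symbol $d$, taking values in $[0,1]$. Thus a language $L$ assigns to each function or relation symbol of arity $n$ a continuity modulus $\varpi:[0,\infty)^n\to[0,\infty)$, which vanishes at $0$, is continuous at $0$ and is upper semicontinuous (for instance, any continuous function vanishing at $0$). An $L$-structure is a nonempty complete metric space of diameter at most $1$ with interpretations of the symbols that respect these moduli and bounds. Formulas are built from atomic formulas with arbitrary continuous connectives $\mathbb R^n\to\mathbb R$ and the quantifiers $\sup_x,\inf_x$. Let $\mathcal C$ be a nonempty elementary class of $L$-structures, that is, a nonempty class of the form $\{M:\theta_i^M\le s_i\text{ for all }i\in I\}$ for some $L$-sentences $\theta_i$ and real numbers $s_i$. Suppose that $L$ is separable for $\mathcal C$: for every $k$ the space of $L$-formulas in $k$ free variables is separable for the seminorm $\|\theta\|=\sup\{|\theta^M(\bar a)|:M\in\mathcal C,\ \bar a\in M^k\}$ (this holds, for example, if $L$ has countably many symbols). A quantifier-free definable predicate (relative to $\mathcal C$) is the limit of a sequence of quantifier-free formulas that is Cauchy for this seminorm. It has an interpretation in every $L$-structure on which the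 sequence is uniformly Cauchy, in particular in every member of $\mathcal C$. Let $C$ be a countably infinite set of new constant symbols and let $L(C)$ be the language $L$ with these symbols added. A *forcing condition* is a finite set of open conditions $\theta<s$ that are satisfied together in some $L(C)$-structure whose $L$-reduct is in $\mathcal C$. Here $s\in\mathbb Q$, and $\theta$ is a quantifier-free $L(C)$-sentence built with the connectives $t\mapsto 1-t$, $t\mapsto t/2$ and $(s,t)\mapsto\min\{s+t,1\}$ only. Let $P$ be a property of $L$-structures axiomatized by a countable family of conditions $\varphi_n\le r_n$ with $r_n\in\mathbb R$, where $$\varphi_n=\sup_{\bar x}\psi_n(\bar x),\qquad \psi_n(\bar x)=\inf_{m\in\mathbb N}\ \inf_{\bar y}\ \sigma_{n,m}(\bar x,\bar y),$$ each $\sigma_{n,m}$ is a quantifier-free definable predicate (the length of the tuple $\bar y$ may depend on $n$ and $m$), and for each $n$ the existential predicates $\inf_{\bar y}\sigma_{n,m}(\bar x,\bar y)$, $m\in\mathbb N$, are uniformly equicontinuous, uniformly over the structures in $\mathcal C$. That is, an $L$-structure $M$ satisfies $P$ if and only if all $\sigma_{n,m}$ have an interpretation in $M$ and $\varphi_n^M\le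 r_n$ for every $n$. Suppose that for every forcing condition $q$, every $n$, every $\varepsilon>0$ and every tuple $\bar c$ from $C$, the set $q\cup\{\psi_n(\bar c)<r_n+\varepsilon\}$ is satisfied in some $L(C)$-structure whose $L$-reduct is in $\mathcal C$. Then there exists a separable $L$-structure satisfying $P$. -/

import Mathlib

open Set Filter Topology
open scoped NNReal

universe v w u

namespace ContinuousLogic

/-! ### Languages and structures (one domain of quantification, all bounds equal to `[0,1]`) -/

/-- Continuity moduli `[0,∞)ⁿ → [0,∞)`: continuous at `0`, vanishing at `0`, and upper
semicontinuous, so that the inequalities they control survive limits. Every continuous function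
vanishing at `0` is an example. -/
structure IsModulus {n : ℕ} (ϖ : (Fin n → ℝ≥0) → ℝ≥0) : Prop where
  map_zero : ϖ 0 = 0
  continuousAt_zero : ContinuousAt ϖ 0
  upperSemicontinuous : UpperSemicontinuous ϖ

/-- A language for metric structures. The metric symbol `d` is always present and is not listed
among the relation symbols. Constant symbols are function symbols of arity `0`. -/
structure MetricLanguage where
  Func : Type v
  Rel : Type w
  funArity : Func → ℕ
  relArity : Rel → ℕ
  funModulus : (f : Func) → (Fin (funArity f) → ℝ≥0) → ℝ≥0
  relModulus : (R : Rel) → (Fin (relArity R) → ℝ≥0) → ℝ≥0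
  isModulus_fun : ∀ f, IsModulus (funModulus f)
  isModulus_rel : ∀ R, IsModulus (relModulus R)

/-- An `L`-structure: a nonempty complete metric space of diameter at most `1`, with
interpretations of the symbols of `L` that respect the prescribed moduli and the bound `[0,1]`. -/
structure MetricStructure (L : MetricLanguage.{v, w}) where
  carrier : Type u
  [metricSpace : MetricSpace carrier]
  [completeSpace : CompleteSpace carrier]
  [nonempty : Nonempty carrier]
  dist_le_one : ∀ a b : carrier, dist a b ≤ 1
  funMap : (f : L.Func) → (Fin (L.funArity f) → carrier) → carrier
  relMap : (R : L.Rel) → (Fin (L.relArity R) → carrier) → ℝ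
  nndist_funMap_le : ∀ (f : L.Func) (a b : Fin (L.funArity f) → carrier),
    nndist (funMap f a) (funMap f b) ≤ L.funModulus f (fun i => nndist (a i) (b i))
  relMap_mem : ∀ (R : L.Rel) (a : Fin (L.relArity R) → carrier), relMap R a ∈ Icc (0 : ℝ) 1
  nndist_relMap_le : ∀ (R : L.Rel) (a b : Fin (L.relArity R) → carrier),
    nndist (relMap R a) (relMap R b) ≤ L.relModulus R (fun i => nndist (a i) (b i))

instance (L : MetricLanguage.{v, w}) : CoeSort (MetricStructure.{v, w, u} L) (Type u) :=
  ⟨MetricStructure.carrier⟩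

attribute [instance] MetricStructure.metricSpace MetricStructure.completeSpace
  MetricStructure.nonempty

/-! ### Terms and formulas -/

/-- `L`-terms in the variables `x₀, …, x_{k-1}`. -/
inductive Term (L : MetricLanguage.{v, w}) (k : ℕ) : Type v
  | var (i : Fin k) : Term L k
  | app (f : L.Func) (ts : Fin (L.funArity f) → Term L k) : Term L k

/-- Interpretation of a term at a tuple. -/
def Term.realize {L : MetricLanguage.{v, w}} {k : ℕ} (M : MetricStructure.{v, w, u} L)
    (a : Fin k → M) : Term L k → M
  | .var i => a i
  | .app f ts => M.funMap f (fun i => (ts i).realize M a)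

/-- `L`-formulas with free variables among `x₀, …, x_{k-1}`. Connectives are arbitrary continuous
functions `ℝⁿ → ℝ`; the quantifiers `sup` and `inf` bind the last variable. -/
inductive Formula (L : MetricLanguage.{v, w}) : ℕ → Type (max v w)
  | rel {k : ℕ} (R : L.Rel) (ts : Fin (L.relArity R) → Term L k) : Formula L k
  | dist {k : ℕ} (s t : Term L k) : Formula L k
  | conn {k n : ℕ} (q : C(Fin n → ℝ, ℝ)) (φs : Fin n → Formula L k) : Formula L k
  | sup {k : ℕ} (φ : Formula L (k + 1)) : Formula L k
  | inf {k : ℕ} (φ : Formula L (k + 1)) : Formula L k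

/-- Interpretation of a formula at a tuple. The suprema and infima are those of bounded
nonempty sets of reals. -/
noncomputable def Formula.realize {L : MetricLanguage.{v, w}} (M : MetricStructure.{v, w, u} L) :
    {k : ℕ} → Formula L k → (Fin k → M) → ℝ
  | _, .rel R ts, a => M.relMap R (fun i => (ts i).realize M a)
  | _, .dist s t, a => Dist.dist (s.realize M a) (t.realize M a)
  | _, .conn q φs, a => q (fun i => (φs i).realize M a)
  | _, .sup φ, a => ⨆ x : M, φ.realize M (Fin.snoc a x)
  | _, .inf φ, a => ⨅ x : M, φ.realize M (Fin.snoc a x)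

/-- A formula is quantifier-free if no quantifier appears in it. -/
inductive Formula.IsQuantifierFree {L : MetricLanguage.{v, w}} {k : ℕ} : Formula L k → Prop
  | rel (R : L.Rel) (ts : Fin (L.relArity R) → Term L k) : IsQuantifierFree (.rel R ts)
  | dist (s t : Term L k) : IsQuantifierFree (.dist s t)
  | conn {n : ℕ} (q : C(Fin n → ℝ, ℝ)) (φs : Fin n → Formula L k)
      (h : ∀ i, IsQuantifierFree (φs i)) : IsQuantifierFree (.conn q φs)

/-! ### Elementary classes and separability -/

/-- A class `𝒞` of `L`-structures is elementary if it is axiomatized by a set of conditions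
`φ ≤ r`, where `φ` is an `L`-sentence and `r` a real number. -/
def IsElementary {L : MetricLanguage.{v, w}} (𝒞 : MetricStructure.{v, w, u} L → Prop) : Prop :=
  ∃ T : Set (Formula L 0 × ℝ), ∀ M, 𝒞 M ↔ ∀ c ∈ T, c.1.realize M Fin.elim0 ≤ c.2

/-- `L` is separable for `𝒞`: for every `k`, the `L`-formulas in `k` free variables have a
countable subset that is dense for the seminorm `‖φ‖ = sup {|φ^M(a)| : M ∈ 𝒞, a ∈ Mᵏ}`. -/
def IsSeparableFor (L : MetricLanguage.{v, w}) (𝒞 : MetricStructure.{v, w, u} L → Prop) : Prop :=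
  ∀ k : ℕ, ∃ S : Set (Formula L k), S.Countable ∧
    ∀ φ : Formula L k, ∀ ε : ℝ, 0 < ε → ∃ ψ ∈ S,
      ∀ M, 𝒞 M → ∀ a : Fin k → M, |φ.realize M a - ψ.realize M a| ≤ ε

/-! ### New constants, restricted formulas and forcing conditions -/

/-- The language `L(C)`: `L` with a new constant symbol for every element of `C`. -/
def MetricLanguage.withConstants (L : MetricLanguage.{v, w}) (C : Type v) :
    MetricLanguage.{v, w} where
  Func := L.Func ⊕ C
  Rel := L.Rel
  funArity := Sum.elim L.funArity (fun _ => 0)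
  relArity := L.relArity
  funModulus
    | .inl f => L.funModulus f
    | .inr _ => fun _ => 0
  relModulus := L.relModulus
  isModulus_fun
    | .inl f => L.isModulus_fun f
    | .inr _ => ⟨rfl, continuousAt_const, upperSemicontinuous_const⟩
  isModulus_rel := L.isModulus_rel

/-- The `L`-reduct of an `L(C)`-structure. -/
def MetricStructure.reduct {L : MetricLanguage.{v, w}} {C : Type v}
    (N : MetricStructure.{v, w, u} (L.withConstants C)) : MetricStructure.{v, w, u} L where
  carrier := N.carrier
  dist_le_one := N.dist_le_one
  funMap f a := N.funMap (Sum.inl f) a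
  relMap R a := N.relMap R a
  nndist_funMap_le f a b := N.nndist_funMap_le (Sum.inl f) a b
  relMap_mem R a := N.relMap_mem R a
  nndist_relMap_le R a b := N.nndist_relMap_le R a b

/-- The interpretation of the new constant symbol `c`, as an element of the reduct. -/
def MetricStructure.const {L : MetricLanguage.{v, w}} {C : Type v}
    (N : MetricStructure.{v, w, u} (L.withConstants C)) (c : C) : N.reduct :=
  N.funMap (Sum.inr c) Fin.elim0

/-- Quantifier-free restricted formulas: the only connectives are `t ↦ 1 - t`, `t ↦ t / 2` and
`(s, t) ↦ min (s + t) 1`. -/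
inductive RestrictedQF (L : MetricLanguage.{v, w}) (k : ℕ) : Type (max v w)
  | rel (R : L.Rel) (ts : Fin (L.relArity R) → Term L k) : RestrictedQF L k
  | dist (s t : Term L k) : RestrictedQF L k
  | oneSub (φ : RestrictedQF L k) : RestrictedQF L k
  | half (φ : RestrictedQF L k) : RestrictedQF L k
  | truncAdd (φ ψ : RestrictedQF L k) : RestrictedQF L k

/-- A restricted quantifier-free formula, seen as a formula. -/
noncomputable def RestrictedQF.toFormula {L : MetricLanguage.{v, w}} {k : ℕ} :
    RestrictedQF L k → Formula L k
  | .rel R ts => .rel R ts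
  | .dist s t => .dist s t
  | .oneSub φ => .conn (n := 1) ⟨fun z => 1 - z 0, by fun_prop⟩ ![φ.toFormula]
  | .half φ => .conn (n := 1) ⟨fun z => z 0 / 2, by fun_prop⟩ ![φ.toFormula]
  | .truncAdd φ ψ =>
      .conn (n := 2) ⟨fun z => min (z 0 + z 1) 1, by fun_prop⟩ ![φ.toFormula, ψ.toFormula]

/-- An open condition `φ < r`, with `φ` a quantifier-free restricted sentence and `r` rational. -/
structure OpenCondition (L : MetricLanguage.{v, w}) where
  sentence : RestrictedQF L 0
  bound : ℚ

/-- The structure `M` satisfies the open condition `φ < r`. -/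
def OpenCondition.Holds {L : MetricLanguage.{v, w}} (o : OpenCondition L)
    (M : MetricStructure.{v, w, u} L) : Prop :=
  o.sentence.toFormula.realize M Fin.elim0 < (o.bound : ℝ)

/-- A forcing condition: a finite set of open conditions on `L(C)`-structures that are satisfied
together in some `L(C)`-structure whose `L`-reduct belongs to `𝒞`. -/
def IsForcingCondition {L : MetricLanguage.{v, w}} {C : Type v}
    (𝒞 : MetricStructure.{v, w, u} L → Prop) (p : Set (OpenCondition (L.withConstants C))) :
    Prop :=
  p.Finite ∧ ∃ N : MetricStructure.{v, w, u} (L.withConstants C),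
    𝒞 N.reduct ∧ ∀ o ∈ p, o.Holds N

/-! ### Definable predicates and infinitary `sup ⋁ inf` sentences -/

/-- A quantifier-free definable predicate relative to `𝒞`: an element of the completion of the
space of quantifier-free formulas for the seminorm given by `𝒞`, represented by a Cauchy sequence
of quantifier-free formulas. -/
structure QFPredicate {L : MetricLanguage.{v, w}} (𝒞 : MetricStructure.{v, w, u} L → Prop)
    (k : ℕ) where
  approx : ℕ → Formula L k
  isQuantifierFree : ∀ i, (approx i).IsQuantifierFree
  cauchy : ∀ ε : ℝ, 0 < ε → ∃ N : ℕ, ∀ i ≥ N, ∀ j ≥ N, ∀ M, 𝒞 M → ∀ a : Fin k → M,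
    |(approx i).realize M a - (approx j).realize M a| ≤ ε

/-- The predicate has an interpretation in `M`: the approximating formulas are uniformly Cauchy
on `M`. This holds for every `M` in `𝒞`. -/
def QFPredicate.InterpretableIn {L : MetricLanguage.{v, w}}
    {𝒞 : MetricStructure.{v, w, u} L → Prop} {k : ℕ} (σ : QFPredicate 𝒞 k)
    (M : MetricStructure.{v, w, u} L) : Prop :=
  UniformCauchySeqOn (fun i (a : Fin k → M) => (σ.approx i).realize M a) atTop univ

/-- The interpretation of a predicate in a structure in which it is interpretable. -/
noncomputable def QFPredicate.realize {L : MetricLanguage.{v, w}}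
    {𝒞 : MetricStructure.{v, w, u} L → Prop} {k : ℕ} (σ : QFPredicate 𝒞 k)
    (M : MetricStructure.{v, w, u} L) (a : Fin k → M) : ℝ :=
  limUnder atTop (fun i => (σ.approx i).realize M a)

/-- `inf_y σ(a, y)`, for `y` ranging over the `l`-tuples of `M`. -/
noncomputable def QFPredicate.infTail {L : MetricLanguage.{v, w}}
    {𝒞 : MetricStructure.{v, w, u} L → Prop} {k l : ℕ} (σ : QFPredicate 𝒞 (k + l))
    (M : MetricStructure.{v, w, u} L) (a : Fin k → M) : EReal :=
  ⨅ y : Fin l → M, (σ.realize M (Fin.append a y) : EReal)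

/-- An infinitary sentence `sup_x inf_m inf_y σ_m(x, y)`, where `x` is a tuple of length `arity`
and the tuple `y` may have a length depending on `m`. The existential predicates
`inf_y σ_m(x, y)`, `m ∈ ℕ`, are required to share a modulus of uniform continuity, uniformly over
the structures in `𝒞`. -/
structure SupInfSentence {L : MetricLanguage.{v, w}}
    (𝒞 : MetricStructure.{v, w, u} L → Prop) where
  arity : ℕ
  innerArity : ℕ → ℕ
  matrix : (m : ℕ) → QFPredicate 𝒞 (arity + innerArity m)
  equicontinuous : ∀ ε : ℝ, 0 < ε → ∃ δ : ℝ, 0 < δ ∧ ∀ m, ∀ M, 𝒞 M → ∀ a b : Fin arity → M,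
    (∀ i, dist (a i) (b i) < δ) → (matrix m).infTail M a ≤ (matrix m).infTail M b + (ε : EReal)

namespace SupInfSentence

variable {L : MetricLanguage.{v, w}} {𝒞 : MetricStructure.{v, w, u} L → Prop}

/-- `ψ^M(a) = inf_m inf_y σ_m^M(a, y)`, an extended real number. -/
noncomputable def disjunction (φ : SupInfSentence 𝒞) (M : MetricStructure.{v, w, u} L)
    (a : Fin φ.arity → M) : EReal :=
  ⨅ m : ℕ, (φ.matrix m).infTail M a

/-- `φ^M = sup_x ψ^M(x)`, an extended real number. -/
noncomputable def value (φ : SupInfSentence 𝒞) (M : MetricStructure.{v, w, u} L) : EReal :=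
  ⨆ a : Fin φ.arity → M, φ.disjunction M a

/-- `M` satisfies the condition `φ ≤ r`: the predicates in `φ` have an interpretation in `M`, and
`φ^M ≤ r`. -/
def Satisfies (φ : SupInfSentence 𝒞) (r : ℝ) (M : MetricStructure.{v, w, u} L) : Prop :=
  (∀ m, (φ.matrix m).InterpretableIn M) ∧ φ.value M ≤ (r : EReal)

end SupInfSentence

/-- The property `P` of `L`-structures is axiomatized by the conditions `φ n ≤ r n`. -/
def IsAxiomatizedBy {L : MetricLanguage.{v, w}} {𝒞 : MetricStructure.{v, w, u} L → Prop}
    {ι : Type*} (P : MetricStructure.{v, w, u} L → Prop) (φ : ι → SupInfSentence 𝒞) (r : ι → ℝ) :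
    Prop :=
  ∀ M, P M ↔ ∀ n, (φ n).Satisfies (r n) M

end ContinuousLogic

namespace ContinuousLogic

/-! ### Moduli -/

/-! The proof is a Baire-category construction whose limit point is an ultralimit. The models with
constants form a space `Models 𝒞 C`, with a basis given by finite sets of open conditions. Three
kinds of requirements are imposed: the value of a term at constants is approximated by a constant;
the bound on `ψ_n(c)`, up to `ε`, is witnessed by a single `σ_{n,m}` and a tuple of constants; and
if constants `a`, `b` are close, then every value `σ(b, d)` is matched up to `ε` by some `σ(a, e)`.

Each requirement is a family of open sets with dense union. Openness holds because quantifier-free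
predicates at constants are continuous on `Models 𝒞 C`. For density, a basic neighbourhood restricts
only finitely many constants, so witnesses found in a model can be named by fresh ones
(`Models.exists_setConst_mem`); the second kind also uses the consistency hypothesis. Separability
of `L` makes countably many requirements suffice, and `exists_generic_sequence` meets them all.

In an ultraproduct of the resulting sequence, the closure of the constants is closed under the
functions, by the first kind of requirement. Its completion `M` is separable, and quantifier-free
predicates are computed in it as limits (`exists_denseRange_ultralimit`). Since `M` need not lie in
`𝒞`, equicontinuity of the existential predicates cannot be quoted there; the third kind of
requirement transfers it to the constants, which is enough for `IsLimitModel.satisfies`. -/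

theorem IsModulus.uniformContinuous {n : ℕ} {ϖ : (Fin n → ℝ≥0) → ℝ≥0} (h : IsModulus ϖ)
    {A B : Type*} [PseudoMetricSpace A] [PseudoMetricSpace B] {g : (Fin n → A) → B}
    (hg : ∀ a b, nndist (g a) (g b) ≤ ϖ fun i => nndist (a i) (b i)) : UniformContinuous g := by
  rw [Metric.uniformContinuous_iff]
  intro ε hε
  obtain ⟨δ, hδ, H⟩ := Metric.continuousAt_iff.1 h.continuousAt_zero ε hε
  refine ⟨δ, hδ, fun {a b} hab => ?_⟩
  have h1 : dist (fun i => nndist (a i) (b i)) 0 < δ := by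
    rw [dist_pi_lt_iff hδ] at hab ⊢
    intro i
    simpa [NNReal.dist_eq] using hab i
  have h2 := H h1
  rw [h.map_zero, NNReal.dist_eq, NNReal.coe_zero, sub_zero, abs_of_nonneg (NNReal.coe_nonneg _)]
    at h2
  exact lt_of_le_of_lt (by exact_mod_cast hg a b) h2

theorem IsModulus.le_of_tendsto {n : ℕ} {ϖ : (Fin n → ℝ≥0) → ℝ≥0} (h : IsModulus ϖ)
    {ι : Type*} {F : Filter ι} [F.NeBot] {x : ι → Fin n → ℝ≥0} {x₀ : Fin n → ℝ≥0}
    {y : ι → ℝ≥0} {y₀ : ℝ≥0} (hx : Tendsto x F (𝓝 x₀)) (hy : Tendsto y F (𝓝 y₀))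
    (hxy : ∀ i, y i ≤ ϖ (x i)) : y₀ ≤ ϖ x₀ := by
  refine le_of_forall_gt_imp_ge_of_dense fun c hc => ?_
  refine _root_.le_of_tendsto hy ?_
  filter_upwards [hx.eventually (h.upperSemicontinuous x₀ c hc)] with i hi
  exact (hxy i).trans hi.le

/-- This is where upper semicontinuity of moduli matters: with continuity at `0` alone, modulus
inequalities could fail on passing from a dense subset to the completion. -/
theorem IsModulus.isClosed_le {n : ℕ} {ϖ : (Fin n → ℝ≥0) → ℝ≥0} (h : IsModulus ϖ)
    {Z : Type*} [TopologicalSpace Z] {F : Z → ℝ≥0} {G : Z → Fin n → ℝ≥0}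
    (hF : Continuous F) (hG : Continuous G) : IsClosed {z | F z ≤ ϖ (G z)} := by
  rw [isClosed_iff_forall_filter]
  intro z 𝓕 _ hs hz
  have : (comap (Subtype.val : {z | F z ≤ ϖ (G z)} → Z) 𝓕).NeBot := by
    refine NeBot.comap_of_range_mem ‹_› ?_
    simpa using hs
  exact h.le_of_tendsto (F := comap (Subtype.val : {z | F z ≤ ϖ (G z)} → Z) 𝓕)
    ((hG.tendsto z).comp ((tendsto_comap (f := Subtype.val)).mono_right hz))
    ((hF.tendsto z).comp ((tendsto_comap (f := Subtype.val)).mono_right hz)) fun i => i.2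

/-! ### Continuity of terms and quantifier-free formulas -/

section

variable {L : MetricLanguage.{v, w}} (M : MetricStructure.{v, w, u} L)

theorem MetricStructure.uniformContinuous_funMap (f : L.Func) : UniformContinuous (M.funMap f) :=
  (L.isModulus_fun f).uniformContinuous (M.nndist_funMap_le f)

theorem MetricStructure.uniformContinuous_relMap (R : L.Rel) : UniformContinuous (M.relMap R) :=
  (L.isModulus_rel R).uniformContinuous (M.nndist_relMap_le R)

theorem Term.uniformContinuous_realize {k : ℕ} (t : Term L k) :
    UniformContinuous fun a : Fin k → M => t.realize M a := by
  induction t with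
  | var i => exact Pi.uniformContinuous_proj _ i
  | app f ts ih =>
    exact (M.uniformContinuous_funMap f).comp (uniformContinuous_pi.2 ih)

/-- A continuous connective is uniformly continuous only on compact sets, so the induction has to
carry bounds along with uniform continuity. -/
theorem Formula.IsQuantifierFree.bounded_and_uniformContinuous {k : ℕ} {φ : Formula L k}
    (hφ : φ.IsQuantifierFree) :
    (∃ B : ℝ, ∀ a : Fin k → M, φ.realize M a ∈ Icc (-B) B) ∧
      UniformContinuous fun a : Fin k → M => φ.realize M a := by
  induction hφ with
  | rel R ts =>
    refine ⟨⟨1, fun a => ⟨?_, ?_⟩⟩, (M.uniformContinuous_relMap R).comp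
      (uniformContinuous_pi.2 fun i => (ts i).uniformContinuous_realize M)⟩
    · have := (M.relMap_mem R fun i => (ts i).realize M a).1
      rw [Formula.realize]; linarith
    · exact (M.relMap_mem R fun i => (ts i).realize M a).2
  | dist s t =>
    refine ⟨⟨1, fun a => ⟨?_, M.dist_le_one _ _⟩⟩,
      (s.uniformContinuous_realize M).dist (t.uniformContinuous_realize M)⟩
    have : 0 ≤ Dist.dist (s.realize M a) (t.realize M a) := _root_.dist_nonneg
    rw [Formula.realize]; linarith
  | @conn n q φs h ih =>
    choose B hB using fun i => (ih i).1
    set K : Set (Fin n → ℝ) := Set.pi univ fun i => Icc (-B i) (B i)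
    have hK : IsCompact K := isCompact_univ_pi fun i => isCompact_Icc
    have hmem : ∀ a : Fin k → M, (fun i => (φs i).realize M a) ∈ K := fun a i _ => hB i a
    constructor
    · obtain ⟨D, hD⟩ := (hK.image q.continuous).isBounded.exists_norm_le
      refine ⟨D, fun a => abs_le.1 (hD _ (mem_image_of_mem _ (hmem a)))⟩
    · have h1 : UniformContinuousOn q K :=
        hK.uniformContinuousOn_of_continuous q.continuous.continuousOn
      have h2 : UniformContinuous fun a : Fin k → M => (fun i => (φs i).realize M a) :=
        uniformContinuous_pi.2 fun i => (ih i).2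
      rw [uniformContinuousOn_iff_restrict] at h1
      exact h1.comp (h2.subtype_mk hmem)

theorem Formula.IsQuantifierFree.uniformContinuous {k : ℕ} {φ : Formula L k}
    (hφ : φ.IsQuantifierFree) : UniformContinuous fun a : Fin k → M => φ.realize M a :=
  (hφ.bounded_and_uniformContinuous M).2

end

/-! ### Prestructures and their completions -/

/-- A prestructure: interpretations of the symbols of `L` on a pseudometric space. -/
structure PreStructure (L : MetricLanguage.{v, w}) (X : Type u) [PseudoMetricSpace X] where
  dist_le_one : ∀ a b : X, dist a b ≤ 1
  funMap : (f : L.Func) → (Fin (L.funArity f) → X) → X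
  relMap : (R : L.Rel) → (Fin (L.relArity R) → X) → ℝ
  nndist_funMap_le : ∀ (f : L.Func) (a b : Fin (L.funArity f) → X),
    nndist (funMap f a) (funMap f b) ≤ L.funModulus f (fun i => nndist (a i) (b i))
  relMap_mem : ∀ (R : L.Rel) (a : Fin (L.relArity R) → X), relMap R a ∈ Icc (0 : ℝ) 1
  nndist_relMap_le : ∀ (R : L.Rel) (a b : Fin (L.relArity R) → X),
    nndist (relMap R a) (relMap R b) ≤ L.relModulus R (fun i => nndist (a i) (b i))

/-! ### Extension of uniformly continuous maps to tuples of the completion. -/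

section Extension

open UniformSpace

variable {X : Type u} [PseudoMetricSpace X]

/-- The canonical map from tuples of a space to tuples of its completion. -/
def piCoe (n : ℕ) : (Fin n → X) → Fin n → Completion X :=
  Pi.map fun _ => ((↑) : X → Completion X)

theorem isUniformInducing_piCoe (n : ℕ) : IsUniformInducing (piCoe (X := X) n) :=
  (Isometry.piMap _ fun _ => Completion.coe_isometry).isUniformInducing

theorem denseRange_piCoe (n : ℕ) : DenseRange (piCoe (X := X) n) :=
  DenseRange.piMap fun _ => Completion.denseRange_coe

variable {Y : Type*} [MetricSpace Y]

/-- The continuous extension to tuples of the completion of a uniformly continuous map. -/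
noncomputable def extendPi {n : ℕ} (g : (Fin n → X) → Y) : (Fin n → Completion X) → Y :=
  ((isUniformInducing_piCoe n).isDenseInducing (denseRange_piCoe n)).extend g

theorem continuous_extendPi [CompleteSpace Y] {n : ℕ} {g : (Fin n → X) → Y} (hg : UniformContinuous g) :
    Continuous (extendPi g) :=
  (uniformContinuous_uniformly_extend (isUniformInducing_piCoe n) (denseRange_piCoe n)
    hg).continuous

theorem extendPi_coe {n : ℕ} {g : (Fin n → X) → Y} (hg : UniformContinuous g) (a : Fin n → X) :
    extendPi g (fun i => (a i : Completion X)) = g a :=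
  IsDenseInducing.extend_eq
    ((isUniformInducing_piCoe n).isDenseInducing (denseRange_piCoe n)) hg.continuous a

theorem nndist_extendPi_le [CompleteSpace Y] {n : ℕ} {g : (Fin n → X) → Y} {ϖ : (Fin n → ℝ≥0) → ℝ≥0}
    (h : IsModulus ϖ) (hg : ∀ a b, nndist (g a) (g b) ≤ ϖ fun i => nndist (a i) (b i))
    (a b : Fin n → Completion X) :
    nndist (extendPi g a) (extendPi g b) ≤ ϖ fun i => nndist (a i) (b i) := by
  have hu := h.uniformContinuous hg
  have hc := continuous_extendPi hu
  refine DenseRange.induction_on₂ (denseRange_piCoe n)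
    (p := fun a b => nndist (extendPi g a) (extendPi g b) ≤ ϖ fun i => nndist (a i) (b i))
    (h.isClosed_le ((hc.comp continuous_fst).nndist (hc.comp continuous_snd)) ?_) ?_ a b
  · fun_prop
  · intro a b
    have ha : extendPi g (piCoe n a) = g a := extendPi_coe hu a
    have hb : extendPi g (piCoe n b) = g b := extendPi_coe hu b
    have hd : ∀ i, nndist (piCoe n a i) (piCoe n b i) = nndist (a i) (b i) := fun i =>
      NNReal.eq (Completion.dist_eq (a i) (b i))
    rw [ha, hb]
    simpa only [hd] using hg a b

end Extension

namespace PreStructure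

open UniformSpace

variable {L : MetricLanguage.{v, w}} {X : Type u} [PseudoMetricSpace X]

/-- The restriction of a prestructure to a set closed under the function symbols. -/
def restrict (S : PreStructure L X) (A : Set X)
    (hA : ∀ f (a : Fin (L.funArity f) → X), (∀ i, a i ∈ A) → S.funMap f a ∈ A) :
    PreStructure L A where
  dist_le_one a b := S.dist_le_one a b
  funMap f a := ⟨S.funMap f fun i => a i, hA f _ fun i => (a i).2⟩
  relMap R a := S.relMap R fun i => a i
  nndist_funMap_le f _ _ := S.nndist_funMap_le f _ _
  relMap_mem R _ := S.relMap_mem R _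
  nndist_relMap_le R _ _ := S.nndist_relMap_le R _ _

variable (S : PreStructure L X)

theorem uniformContinuous_funMap (f : L.Func) : UniformContinuous (S.funMap f) :=
  (L.isModulus_fun f).uniformContinuous (S.nndist_funMap_le f)

theorem uniformContinuous_relMap (R : L.Rel) : UniformContinuous (S.relMap R) :=
  (L.isModulus_rel R).uniformContinuous (S.nndist_relMap_le R)

/-- The completion of a prestructure. -/
noncomputable def completion [Nonempty X] : MetricStructure.{v, w, u} L where
  carrier := Completion X
  nonempty := ⟨((Classical.arbitrary X : X) : Completion X)⟩
  dist_le_one a b := by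
    refine Completion.induction_on₂ a b (isClosed_le (by fun_prop) (by fun_prop)) fun a b => ?_
    rw [Completion.dist_eq]
    exact S.dist_le_one a b
  funMap f := extendPi fun a => ((S.funMap f a : X) : Completion X)
  relMap R := extendPi (S.relMap R)
  nndist_funMap_le f a b := by
    refine nndist_extendPi_le (L.isModulus_fun f) (fun a b => ?_) a b
    have : nndist ((S.funMap f a : X) : Completion X) (S.funMap f b : X) =
      nndist (S.funMap f a) (S.funMap f b) := NNReal.eq (Completion.dist_eq _ _)
    rw [this]
    exact S.nndist_funMap_le f a b
  relMap_mem R a := by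
    refine (denseRange_piCoe _).induction_on (p := fun a => extendPi (S.relMap R) a ∈ Icc (0 : ℝ) 1)
      a (isClosed_Icc.preimage (continuous_extendPi (S.uniformContinuous_relMap R))) fun a => ?_
    have : extendPi (S.relMap R) (piCoe _ a) = S.relMap R a :=
      extendPi_coe (S.uniformContinuous_relMap R) a
    rw [this]
    exact S.relMap_mem R a
  nndist_relMap_le R a b := nndist_extendPi_le (L.isModulus_rel R) (S.nndist_relMap_le R) a b

variable [Nonempty X]

theorem completion_funMap_coe (f : L.Func) (a : Fin (L.funArity f) → X) :
    S.completion.funMap f (fun i => (a i : Completion X)) = ((S.funMap f a : X) : Completion X) :=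
  extendPi_coe (Y := Completion X)
    ((Completion.uniformContinuous_coe X).comp (S.uniformContinuous_funMap f)) a

theorem completion_relMap_coe (R : L.Rel) (a : Fin (L.relArity R) → X) :
    S.completion.relMap R (fun i => (a i : Completion X)) = S.relMap R a :=
  extendPi_coe (S.uniformContinuous_relMap R) a

end PreStructure

/-! ### Ultraproducts -/

theorem tendsto_ultrafilter_limUnder {I : Type*} (U : Ultrafilter I) {K : Set ℝ}
    (hK : IsCompact K) {f : I → ℝ} (hf : ∀ i, f i ∈ K) :
    Tendsto f U (𝓝 (limUnder U f)) := by
  obtain ⟨x, -, hx⟩ := hK.ultrafilter_le_nhds (U.map f)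
    (le_principal_iff.2 (Eventually.of_forall hf : ∀ᶠ i in (U : Filter I), f i ∈ K))
  exact tendsto_nhds_limUnder ⟨x, hx⟩

section Ultraproduct

variable {L : MetricLanguage.{v, w}} {I : Type} (N : I → MetricStructure.{v, w, u} L)
  (U : Ultrafilter I)

/-- The product of a family of metric structures, with the pseudometric that is the limit along
the ultrafilter `U` of the metrics of the factors. -/
def UltraPi (N : I → MetricStructure.{v, w, u} L) (_ : Ultrafilter I) : Type u := ∀ i, N i

instance : Nonempty (UltraPi N U) := ⟨fun i => Classical.arbitrary (N i)⟩

theorem tendsto_ultraDist (a b : UltraPi N U) :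
    Tendsto (fun i => dist (a i) (b i)) U (𝓝 (limUnder U fun i => dist (a i) (b i))) :=
  tendsto_ultrafilter_limUnder U isCompact_Icc
    fun i => ⟨dist_nonneg, (N i).dist_le_one _ _⟩

/-- Elements at limit distance `0` are not identified here; the Hausdorff completion does that
later. -/
noncomputable instance : PseudoMetricSpace (UltraPi N U) where
  dist a b := limUnder U fun i => dist (a i) (b i)
  dist_self a := by
    refine tendsto_nhds_unique (tendsto_ultraDist N U a a) ?_
    simp
  dist_comm a b := by simp only [dist_comm]
  dist_triangle a b c :=
    le_of_tendsto_of_tendsto' (tendsto_ultraDist N U a c)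
      ((tendsto_ultraDist N U a b).add (tendsto_ultraDist N U b c)) fun i => dist_triangle _ _ _

variable {N U}

theorem UltraPi.tendsto_dist (a b : UltraPi N U) :
    Tendsto (fun i => dist (a i) (b i)) U (𝓝 (dist a b)) :=
  tendsto_ultraDist N U a b

theorem UltraPi.tendsto_nndist (a b : UltraPi N U) :
    Tendsto (fun i => nndist (a i) (b i)) U (𝓝 (nndist a b)) :=
  NNReal.tendsto_coe.1 (UltraPi.tendsto_dist a b)

/-- The coordinatewise interpretation of a function symbol. -/
def UltraPi.funMap (f : L.Func) (a : Fin (L.funArity f) → UltraPi N U) : UltraPi N U :=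
  fun i => (N i).funMap f fun j => a j i

theorem tendsto_ultraRel (R : L.Rel) (a : Fin (L.relArity R) → UltraPi N U) :
    Tendsto (fun i => (N i).relMap R fun j => a j i) U
      (𝓝 (limUnder U fun i => (N i).relMap R fun j => a j i)) :=
  tendsto_ultrafilter_limUnder U isCompact_Icc fun i => (N i).relMap_mem R _

variable (N U)

/-- The metric ultraproduct, as a prestructure. -/
noncomputable def ultraproduct : PreStructure L (UltraPi N U) where
  dist_le_one a b := le_of_tendsto' (UltraPi.tendsto_dist a b) fun i => (N i).dist_le_one _ _
  funMap := UltraPi.funMap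
  relMap R a := limUnder U fun i => (N i).relMap R fun j => a j i
  nndist_funMap_le f a b := by
    have hx : Tendsto (fun i j => nndist (a j i) (b j i)) U (𝓝 fun j => nndist (a j) (b j)) :=
      tendsto_pi_nhds.2 fun j => UltraPi.tendsto_nndist (a j) (b j)
    have hy := UltraPi.tendsto_nndist (UltraPi.funMap f a) (UltraPi.funMap f b)
    exact (L.isModulus_fun f).le_of_tendsto hx hy fun i => (N i).nndist_funMap_le f _ _
  relMap_mem R a := isClosed_Icc.mem_of_tendsto (tendsto_ultraRel R a)
    (Eventually.of_forall fun i => (N i).relMap_mem R _)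
  nndist_relMap_le R a b := by
    have hx : Tendsto (fun i j => nndist (a j i) (b j i)) U (𝓝 fun j => nndist (a j) (b j)) :=
      tendsto_pi_nhds.2 fun j => UltraPi.tendsto_nndist (a j) (b j)
    have hy := (tendsto_ultraRel R a).nndist (tendsto_ultraRel R b)
    exact (L.isModulus_rel R).le_of_tendsto hx hy fun i => (N i).nndist_relMap_le R _ _

variable {N U}

/-- The substructure of an ultraproduct generated by a family of elements which is almost closed
under the function symbols: the family is dense in it, and quantifier-free formulas are evaluated
in it coordinatewise. -/
theorem exists_denseRange_ultralimit {C : Type*} [Nonempty C] (a : C → ∀ i, N i)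
    (ha : ∀ f (c : Fin (L.funArity f) → C) (ε : ℝ), 0 < ε → ∃ c',
      ∀ᶠ i in (U : Filter I), dist ((N i).funMap f fun j => a (c j) i) (a c' i) ≤ ε) :
    ∃ (M : MetricStructure.{v, w, u} L) (g : C → M), DenseRange g ∧
      ∀ {k : ℕ} {φ : Formula L k}, φ.IsQuantifierFree → ∀ c : Fin k → C,
        Tendsto (fun i => φ.realize (N i) fun j => a (c j) i) U
          (𝓝 (φ.realize M fun j => g (c j))) := by
  set S := ultraproduct N U
  let b : C → UltraPi N U := a
  set A : Set (UltraPi N U) := closure (range b)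
  have hAS : ∀ f (x : Fin (L.funArity f) → UltraPi N U), (∀ i, x i ∈ A) → S.funMap f x ∈ A := by
    intro f x hx
    have hmaps : MapsTo (S.funMap f) (Set.pi univ fun _ => range b) A := by
      intro y hy
      choose c hc using fun j => hy j (mem_univ j)
      refine Metric.mem_closure_iff.2 fun ε hε => ?_
      obtain ⟨c', hc'⟩ := ha f c (ε / 2) (half_pos hε)
      refine ⟨b c', mem_range_self _, lt_of_le_of_lt ?_ (half_lt_self hε)⟩
      obtain rfl : (fun j => b (c j)) = y := funext hc
      exact le_of_tendsto (UltraPi.tendsto_dist _ _) hc'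
    -- By continuity, the inclusion extends from tuples of generators to the closure of their
    -- product, which is the product of the closures.
    have h2 := hmaps.closure (S.uniformContinuous_funMap f).continuous
    rw [closure_pi_set, isClosed_closure.closure_eq] at h2
    exact h2 fun i _ => hx i
  have hbA : ∀ c, b c ∈ A := fun c => subset_closure (mem_range_self c)
  have : Nonempty A := ⟨⟨b (Classical.arbitrary C), hbA _⟩⟩
  let T := S.restrict A hAS
  let g₀ : C → A := fun c => ⟨b c, hbA c⟩
  have hg₀ : DenseRange g₀ := by
    intro x
    rw [closure_subtype, ← range_comp]
    exact x.2
  let M := T.completion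
  let ι : A → M := fun x => (x : UniformSpace.Completion A)
  have hι : ∀ x y : A, dist (ι x) (ι y) = dist (x : UltraPi N U) y :=
    fun x y => UniformSpace.Completion.dist_eq x y
  -- Terms at the generators are computed exactly coordinatewise; limits enter only in atomic
  -- formulas.
  have hterm : ∀ {k : ℕ} (t : Term L k) (c : Fin k → C), ∃ x : A,
      t.realize M (fun j => ι (g₀ (c j))) = ι x ∧
        ∀ i, (x : UltraPi N U) i = t.realize (N i) fun j => a (c j) i := by
    intro k t c
    induction t with
    | var j => exact ⟨g₀ (c j), rfl, fun i => rfl⟩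
    | app f ts ih =>
      choose x hx hx' using ih
      refine ⟨T.funMap f x, ?_, fun i => ?_⟩
      · simp only [Term.realize, hx]
        exact T.completion_funMap_coe f x
      · simp only [Term.realize, ← hx']
        rfl
  refine ⟨M, fun c => ι (g₀ c), UniformSpace.Completion.denseRange_coe.comp hg₀
    (UniformSpace.Completion.continuous_coe A), ?_⟩
  intro k φ hφ c
  induction hφ with
  | rel R ts =>
    choose x hx hx' using fun j => hterm (ts j) c
    simp only [Formula.realize, hx, ← hx']
    have : M.relMap R (fun j => ι (x j)) = T.relMap R x := T.completion_relMap_coe R x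
    rw [this]
    exact tendsto_ultraRel R fun j => (x j : UltraPi N U)
  | dist s t =>
    obtain ⟨x, hx, hx'⟩ := hterm s c
    obtain ⟨y, hy, hy'⟩ := hterm t c
    simp only [Formula.realize, hx, hy, ← hx', ← hy', hι]
    exact UltraPi.tendsto_dist _ _
  | conn q φs _ ih =>
    simp only [Formula.realize]
    exact (q.continuous.tendsto _).comp (tendsto_pi_nhds.2 ih)

end Ultraproduct

/-! ### Generic sequences -/

/-- Given countably many requirements, each of which is met by a dense family of open sets, there
is a sequence that eventually stays in one open set of each of the families. -/
theorem exists_generic_sequence {X : Type*} [TopologicalSpace X] [Nonempty X]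
    {𝓡 : Set (Set (Set X))} (hcount : 𝓡.Countable) (hopen : ∀ R ∈ 𝓡, ∀ V ∈ R, IsOpen V)
    (hdense : ∀ R ∈ 𝓡, ∀ O, IsOpen O → O.Nonempty → ∃ V ∈ R, (O ∩ V).Nonempty) :
    ∃ x : ℕ → X, ∀ R ∈ 𝓡, ∃ V ∈ R, ∀ᶠ k in atTop, x k ∈ V := by
  rcases 𝓡.eq_empty_or_nonempty with rfl | h𝓡
  · exact ⟨fun _ => Classical.arbitrary X, fun R hR => hR.elim⟩
  obtain ⟨e, rfl⟩ := hcount.exists_eq_range h𝓡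
  rw [forall_mem_range] at hopen hdense
  choose V hVR hV using hdense
  let Op := {O : Set X // IsOpen O ∧ O.Nonempty}
  let next : ℕ → Op → Op := fun k O =>
    ⟨O.1 ∩ V k O.1 O.2.1 O.2.2, O.2.1.inter (hopen k _ (hVR k _ _ _)), hV k O.1 O.2.1 O.2.2⟩
  let O : ℕ → Op := Nat.rec ⟨univ, isOpen_univ, univ_nonempty⟩ next
  have hanti : Antitone fun k => (O k).1 := antitone_nat_of_succ_le fun k => inter_subset_left
  -- The decreasing open sets may have empty intersection, so one point is chosen in each of them;
  -- no completeness or compactness is needed.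
  choose x hx using fun k => (O k).2.2
  refine ⟨x, forall_mem_range.2 fun k => ⟨_, hVR k (O k).1 (O k).2.1 (O k).2.2, ?_⟩⟩
  filter_upwards [eventually_ge_atTop (k + 1)] with l hl
  have h1 : (O (k + 1)).1 ⊆ V k (O k).1 (O k).2.1 (O k).2.2 := inter_subset_right
  exact h1 (hanti hl (hx l))

/-! ### The space of models with constants -/

section Substitution

variable {L : MetricLanguage.{v, w}} {C : Type v}

/-- The closed `L(C)`-term obtained from an `L`-term by substituting constants for variables. -/
def Term.substConst {k : ℕ} (c : Fin k → C) : Term L k → Term (L.withConstants C) 0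
  | .var i => .app (L := L.withConstants C) (.inr (c i)) Fin.elim0
  | .app f ts => .app (L := L.withConstants C) (.inl f) fun i => (ts i).substConst c

theorem Term.realize_substConst {k : ℕ} (c : Fin k → C) (t : Term L k)
    (N : MetricStructure.{v, w, u} (L.withConstants C)) :
    (t.substConst c).realize N Fin.elim0 = t.realize N.reduct fun i => N.const (c i) := by
  induction t with
  | var i =>
    refine congrArg (N.funMap (.inr (c i))) ?_
    funext j
    exact Fin.elim0 j
  | app f ts ih => exact congrArg (N.funMap (.inl f)) (funext ih)

/-- The `L(C)`-structure in which the new constants are reinterpreted by `g`. -/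
def MetricStructure.setConst (N : MetricStructure.{v, w, u} (L.withConstants C)) (g : C → N) :
    MetricStructure.{v, w, u} (L.withConstants C) where
  carrier := N.carrier
  dist_le_one := N.dist_le_one
  funMap
    | .inl f => N.funMap (.inl f)
    | .inr c => fun _ => g c
  relMap := N.relMap
  nndist_funMap_le
    | .inl f => N.nndist_funMap_le (.inl f)
    | .inr c => fun _ _ => by simp
  relMap_mem := N.relMap_mem
  nndist_relMap_le := N.nndist_relMap_le

/-- The `L(C)`-structure obtained from an `L`-structure by interpreting the constants by `g`. -/
def MetricStructure.expand (M : MetricStructure.{v, w, u} L) (g : C → M) :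
    MetricStructure.{v, w, u} (L.withConstants C) where
  carrier := M.carrier
  dist_le_one := M.dist_le_one
  funMap
    | .inl f => M.funMap f
    | .inr c => fun _ => g c
  relMap := M.relMap
  nndist_funMap_le
    | .inl f => M.nndist_funMap_le f
    | .inr c => fun _ _ => by simp
  relMap_mem := M.relMap_mem
  nndist_relMap_le := M.nndist_relMap_le

variable (N : MetricStructure.{v, w, u} (L.withConstants C))

theorem MetricStructure.setConst_const : N.setConst N.const = N := by
  cases N with
  | mk _ _ funMap _ _ _ _ =>
    simp only [setConst, mk.injEq, heq_eq_eq, true_and, and_true]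
    funext f a
    cases f with
    | inl f => rfl
    | inr c =>
      refine congrArg (funMap (.inr c)) ?_
      funext j
      exact Fin.elim0 j

theorem Term.continuous_realize_setConst (t : Term (L.withConstants C) 0) :
    Continuous fun g : C → N => (show N from t.realize (N.setConst g) Fin.elim0) := by
  induction t with
  | var i => exact Fin.elim0 i
  | app f ts ih =>
    cases f with
    | inl f => exact (N.uniformContinuous_funMap (.inl f)).continuous.comp (continuous_pi ih)
    | inr c => exact continuous_apply c

theorem RestrictedQF.continuous_realize_setConst (θ : RestrictedQF (L.withConstants C) 0) :
    Continuous fun g : C → N => θ.toFormula.realize (N.setConst g) Fin.elim0 := by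
  induction θ with
  | rel R ts =>
    exact (N.uniformContinuous_relMap R).continuous.comp
      (continuous_pi fun i => (ts i).continuous_realize_setConst N)
  | dist s t =>
    exact (s.continuous_realize_setConst N).dist (t.continuous_realize_setConst N)
  | oneSub θ ih =>
    simp only [toFormula, Formula.realize, ContinuousMap.coe_mk, Matrix.cons_val_zero]
    exact continuous_const.sub ih
  | half θ ih =>
    simp only [toFormula, Formula.realize, ContinuousMap.coe_mk, Matrix.cons_val_zero]
    exact ih.div_const 2
  | truncAdd θ θ' ih ih' =>
    simp only [toFormula, Formula.realize, ContinuousMap.coe_mk, Matrix.cons_val_zero,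
      Matrix.cons_val_one]
    exact (ih.add ih').min continuous_const

end Substitution

section Models

variable {L : MetricLanguage.{v, w}} (𝒞 : MetricStructure.{v, w, u} L → Prop) (C : Type v)

/-- The `L(C)`-structures with reduct in `𝒞`. -/
def Models : Type _ :=
  {N : MetricStructure.{v, w, u} (L.withConstants C) // 𝒞 N.reduct}

/-- The topology in which the forcing conditions are the basic open sets. -/
instance : TopologicalSpace (Models 𝒞 C) :=
  .generateFrom (range fun o : OpenCondition (L.withConstants C) => {N | o.Holds N.1})

variable {𝒞 C}

theorem OpenCondition.isOpen (o : OpenCondition (L.withConstants C)) :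
    IsOpen {N : Models 𝒞 C | o.Holds N.1} :=
  .basic _ (mem_range_self o)

/-- Finite intersections of subbasic sets form a basis, and the point `N` itself witnesses
consistency. This translates the hypothesis on forcing conditions into density. -/
theorem Models.exists_isForcingCondition {O : Set (Models 𝒞 C)} (hO : IsOpen O)
    {N : Models 𝒞 C} (hN : N ∈ O) :
    ∃ q : Set (OpenCondition (L.withConstants C)), IsForcingCondition 𝒞 q ∧
      ∀ N' : Models 𝒞 C, (∀ o ∈ q, o.Holds N'.1) → N' ∈ O := by
  have hb := TopologicalSpace.isTopologicalBasis_of_subbasis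
    (rfl : (inferInstance : TopologicalSpace (Models 𝒞 C)) = _)
  obtain ⟨_, ⟨F, ⟨hF, hFs⟩, rfl⟩, hNF, hFO⟩ := hb.exists_subset_of_mem_open hN hO
  choose f hf using hFs
  have := hF.to_subtype
  refine ⟨range fun V : F => f V.2, ⟨finite_range _, N.1, N.2, ?_⟩, fun N' hN' => hFO ?_⟩
  · rintro _ ⟨V, rfl⟩
    have h := hNF V.1 V.2
    rw [← hf V.2] at h
    exact h
  · intro V hV
    rw [← hf hV]
    exact hN' _ ⟨⟨V, hV⟩, rfl⟩

/-- Rational thresholds give all lower half-lines by density of `ℚ`, and the connective `1 - t`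
exchanges upper and lower half-lines. -/
theorem RestrictedQF.continuous_realize {θ : RestrictedQF (L.withConstants C) 0} :
    Continuous fun N : Models 𝒞 C => θ.toFormula.realize N.1 Fin.elim0 := by
  have hlt : ∀ (θ : RestrictedQF (L.withConstants C) 0) (b : ℝ),
      IsOpen {N : Models 𝒞 C | θ.toFormula.realize N.1 Fin.elim0 < b} := by
    intro θ b
    have : {N : Models 𝒞 C | θ.toFormula.realize N.1 Fin.elim0 < b} =
        ⋃ s : {s : ℚ // (s : ℝ) < b}, {N | (OpenCondition.mk θ s).Holds N.1} := by
      ext N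
      simp only [mem_ofPred_eq, mem_iUnion, OpenCondition.Holds]
      refine ⟨fun h => ?_, fun ⟨s, hs⟩ => hs.trans s.2⟩
      obtain ⟨s, h1, h2⟩ := exists_rat_btwn h
      exact ⟨⟨s, h2⟩, h1⟩
    rw [this]
    exact isOpen_iUnion fun s => OpenCondition.isOpen _
  rw [OrderTopology.topology_eq_generate_intervals (α := ℝ), continuous_generateFrom_iff]
  rintro _ ⟨b, rfl | rfl⟩
  · convert hlt θ.oneSub (1 - b) using 1
    ext N
    simp [RestrictedQF.toFormula, Formula.realize]
  · exact hlt θ b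

theorem Models.continuous_dist_realize {k l : ℕ} (s : Term L k) (t : Term L l) (c : Fin k → C)
    (d : Fin l → C) : Continuous fun N : Models 𝒞 C =>
      dist (s.realize N.1.reduct fun i => N.1.const (c i))
        (t.realize N.1.reduct fun i => N.1.const (d i)) := by
  convert RestrictedQF.continuous_realize (𝒞 := 𝒞)
    (θ := .dist (L := L.withConstants C) (s.substConst c) (t.substConst d)) using 2 with N
  simp only [RestrictedQF.toFormula, Formula.realize, Term.realize_substConst]
  rfl

/-- Atomic formulas at constants are restricted sentences, and arbitrary connectives preserve
continuity. Thus the few connectives allowed in forcing conditions lose nothing. -/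
theorem Formula.IsQuantifierFree.continuous_realize_const {k : ℕ} {φ : Formula L k}
    (hφ : φ.IsQuantifierFree) (c : Fin k → C) :
    Continuous fun N : Models 𝒞 C => φ.realize N.1.reduct fun i => N.1.const (c i) := by
  induction hφ with
  | rel R ts =>
    convert RestrictedQF.continuous_realize (𝒞 := 𝒞)
      (θ := .rel (L := L.withConstants C) R fun i => (ts i).substConst c) using 2 with N
    simp only [RestrictedQF.toFormula, Formula.realize, Term.realize_substConst]
    rfl
  | dist s t => exact Models.continuous_dist_realize s t c c
  | conn q φs _ ih => exact q.continuous.comp (continuous_pi ih)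

/-- Reinterpretation of the new constants. -/
def Models.setConst (N : Models 𝒞 C) (g : C → N.1) : Models 𝒞 C := ⟨N.1.setConst g, N.2⟩

theorem Models.continuous_setConst (N : Models 𝒞 C) :
    Continuous fun g : C → N.1 => N.setConst g := by
  refine continuous_generateFrom_iff.2 ?_
  rintro _ ⟨o, rfl⟩
  exact isOpen_lt (o.sentence.continuous_realize_setConst N.1) continuous_const

/-- Fresh constants can be used to name the elements of a tuple. -/
theorem Models.exists_setConst_mem [Infinite C] {O : Set (Models 𝒞 C)} (hO : IsOpen O)
    {N : Models 𝒞 C} (hN : N ∈ O) (F : Finset C) {l : ℕ} (y : Fin l → N.1) :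
    ∃ (g : C → N.1) (d : Fin l → C), (∀ c ∈ F, g c = N.1.const c) ∧ (∀ i, g (d i) = y i) ∧
      N.setConst g ∈ O := by
  classical
  have hpre := hO.preimage N.continuous_setConst
  -- A neighbourhood in the product topology restricts only the coordinates in the finite set `I`;
  -- constants outside `I ∪ F` may be reinterpreted freely.
  obtain ⟨I, V, hV, hVO⟩ := isOpen_pi_iff.1 hpre N.1.const (by
    have : N.setConst N.1.const = N :=
      Subtype.ext N.1.setConst_const
    show N.setConst N.1.const ∈ O
    rw [this]
    exact hN)
  obtain ⟨d⟩ : Nonempty (Fin l ↪ {c : C // c ∉ I ∪ F}) := by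
    have : Infinite {c : C // c ∉ I ∪ F} := (I ∪ F).finite_toSet.infinite_compl.to_subtype
    exact ⟨Fin.valEmbedding.trans (Infinite.natEmbedding _)⟩
  have hinj : Function.Injective fun i => (d i : C) := Subtype.val_injective.comp d.injective
  have hfresh : ∀ c ∈ I ∪ F, Function.extend (fun i => (d i : C)) y N.1.const c = N.1.const c :=
    fun c hc => Function.extend_apply' _ _ _ fun ⟨i, hi⟩ => (d i).2 (hi ▸ hc)
  refine ⟨Function.extend (fun i => (d i : C)) y N.1.const, fun i => d i,
    fun c hc => hfresh c (Finset.mem_union_right _ hc), fun i => hinj.extend_apply _ _ _,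
    hVO fun c hc => ?_⟩
  rw [hfresh c (Finset.mem_union_left _ hc)]
  exact (hV c hc).2

end Models

variable {L : MetricLanguage.{v, w}} {𝒞 : MetricStructure.{v, w, u} L → Prop}

/-! ### Quantifier-free definable predicates -/

section Predicates

variable {k : ℕ} (σ : QFPredicate 𝒞 k)

theorem QFPredicate.interpretableIn {M : MetricStructure.{v, w, u} L} (hM : 𝒞 M) :
    σ.InterpretableIn M := by
  refine Metric.uniformCauchySeqOn_iff.2 fun ε hε => ?_
  obtain ⟨n, hn⟩ := σ.cauchy (ε / 2) (half_pos hε)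
  exact ⟨n, fun i hi j hj a _ => (hn i hi j hj M hM a).trans_lt (half_lt_self hε)⟩

variable {σ}

theorem QFPredicate.InterpretableIn.tendsto {M : MetricStructure.{v, w, u} L}
    (h : σ.InterpretableIn M) (a : Fin k → M) :
    Tendsto (fun i => (σ.approx i).realize M a) atTop (𝓝 (σ.realize M a)) :=
  (UniformCauchySeqOn.cauchySeq h (mem_univ a)).tendsto_limUnder

theorem QFPredicate.InterpretableIn.uniformContinuous {M : MetricStructure.{v, w, u} L}
    (h : σ.InterpretableIn M) : UniformContinuous fun a : Fin k → M => σ.realize M a := by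
  have := tendstoUniformlyOn_univ.1
    (UniformCauchySeqOn.tendstoUniformlyOn_of_tendsto h fun a _ => h.tendsto a)
  exact this.uniformContinuous
    (Frequently.of_forall fun i => (σ.isQuantifierFree i).uniformContinuous M)

variable (σ)

/-- The Cauchy condition is uniform over `𝒞`, hence over all models with constants. This gives both
continuity of the predicate on the space of models and the interchange of limits in
`IsLimitModel.tendsto_predicate`. -/
theorem QFPredicate.tendstoUniformly_const {C : Type v} (c : Fin k → C) :
    TendstoUniformly
      (fun i (N : Models 𝒞 C) => (σ.approx i).realize N.1.reduct fun j => N.1.const (c j))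
      (fun N => σ.realize N.1.reduct fun j => N.1.const (c j)) atTop := by
  rw [← tendstoUniformlyOn_univ]
  refine UniformCauchySeqOn.tendstoUniformlyOn_of_tendsto ?_
    fun N _ => (σ.interpretableIn N.2).tendsto _
  refine Metric.uniformCauchySeqOn_iff.2 fun ε hε => ?_
  obtain ⟨n, hn⟩ := σ.cauchy (ε / 2) (half_pos hε)
  exact ⟨n, fun i hi j hj N _ => (hn i hi j hj _ N.2 _).trans_lt (half_lt_self hε)⟩

theorem QFPredicate.continuous_realize_const {C : Type v} (c : Fin k → C) :
    Continuous fun N : Models 𝒞 C => σ.realize N.1.reduct fun j => N.1.const (c j) :=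
  (σ.tendstoUniformly_const c).continuous
    (Frequently.of_forall fun i => (σ.isQuantifierFree i).continuous_realize_const c)

end Predicates

/-! ### Separability -/

/-- A term, seen as a term with one more variable. -/
def Term.lift {k : ℕ} : Term L k → Term L (k + 1)
  | .var i => .var i.castSucc
  | .app f ts => .app f fun i => (ts i).lift

theorem Term.realize_lift {k : ℕ} (t : Term L k) (M : MetricStructure.{v, w, u} L)
    (a : Fin k → M) (x : M) :
    t.lift.realize M (Fin.snoc (α := fun _ => M) a x) = t.realize M a := by
  induction t with
  | var i => exact Fin.snoc_castSucc (α := fun _ => M) x a i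
  | app f ts ih => exact congrArg (M.funMap f) (funext ih)

/-- A term `t` is encoded by the formula `d(t(x), y)` with a new variable `y`. If `t` and `t'` are
near the same formula, evaluating at `y = t'(x)` bounds `d(t, t')`; so one term is selected for each
dense formula and accuracy. -/
theorem IsSeparableFor.exists_countable_dense_terms (h : IsSeparableFor L 𝒞) (k : ℕ) :
    ∃ T : Set (Term L k), T.Countable ∧ ∀ t : Term L k, ∀ ε : ℝ, 0 < ε → ∃ t' ∈ T,
      ∀ M, 𝒞 M → ∀ a : Fin k → M, dist (t.realize M a) (t'.realize M a) ≤ ε := by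
  obtain ⟨S, hS, hdense⟩ := h (k + 1)
  let near (ψ : Formula L (k + 1)) (n : ℕ) (t : Term L k) : Prop :=
    ∀ M, 𝒞 M → ∀ a : Fin (k + 1) → M,
      |(Formula.dist t.lift (.var (Fin.last k))).realize M a - ψ.realize M a| ≤ 1 / (n + 1 : ℝ)
  have : Countable S := hS.to_subtype
  refine ⟨range fun p : {p : S × ℕ // ∃ t, near p.1 p.2 t} => p.2.choose, countable_range _,
    fun t ε hε => ?_⟩
  obtain ⟨n, hn⟩ := exists_nat_one_div_lt (half_pos hε)
  obtain ⟨ψ, hψ, ht⟩ := hdense (.dist t.lift (.var (Fin.last k))) (1 / (n + 1 : ℝ))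
    Nat.one_div_pos_of_nat
  have hex : ∃ t, near ψ n t := ⟨t, ht⟩
  refine ⟨hex.choose, ⟨⟨(⟨ψ, hψ⟩, n), hex⟩, rfl⟩, fun M hM a => ?_⟩
  set t' := hex.choose
  have h1 := ht M hM (Fin.snoc (α := fun _ => M) a (t'.realize M a))
  have h2 := hex.choose_spec M hM (Fin.snoc (α := fun _ => M) a (t'.realize M a))
  simp only [Formula.realize, Term.realize, Term.realize_lift, Fin.snoc_last] at h1 h2
  change |dist (t'.realize M a) (t'.realize M a) - _| ≤ _ at h2
  rw [dist_self] at h2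
  rw [abs_le] at h1 h2
  linarith [h1.2, h2.1]

/-! ### Generic models -/

theorem comp_append {A B : Type*} (g : A → B) {k l : ℕ} (a : Fin k → A) (b : Fin l → A) :
    (fun i => g (Fin.append a b i)) = Fin.append (fun i => g (a i)) fun i => g (b i) := by
  funext i
  refine Fin.addCases (fun i => ?_) (fun i => ?_) i <;> simp

theorem QFPredicate.infTail_lt_iff {k l : ℕ} (σ : QFPredicate 𝒞 (k + l))
    {M : MetricStructure.{v, w, u} L} {a : Fin k → M} {s : ℝ} :
    σ.infTail M a < (s : EReal) ↔ ∃ y, σ.realize M (Fin.append a y) < s := by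
  simp [QFPredicate.infTail, iInf_lt_iff]

/-- The elements named by a tuple of constants and a tuple of new elements can be named by
constants, without leaving an open set and without changing the meaning of given constants. -/
theorem Models.exists_const_eq {C : Type v} [Infinite C] {O : Set (Models 𝒞 C)} (hO : IsOpen O)
    {N : Models 𝒞 C} (hN : N ∈ O) {k l : ℕ} (c : Fin k → C) (y : Fin l → N.1) :
    ∃ (g : C → N.1) (d : Fin l → C), N.setConst g ∈ O ∧ (∀ i, g (c i) = N.1.const (c i)) ∧
      ∀ i, g (d i) = y i := by
  classical
  obtain ⟨g, d, h1, h2, h3⟩ := N.exists_setConst_mem hO hN (Finset.univ.image c) y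
  exact ⟨g, d, h3, fun i => h1 _ (by simp), h2⟩

/-! ### Requirements: openness and density. -/

/-- The requirement that the value of the term `t` at `c` is `ε`-close to a constant. -/
def termRequirement (𝒞 : MetricStructure.{v, w, u} L → Prop) {C : Type v} {k : ℕ} (t : Term L k)
    (c : Fin k → C) (ε : ℝ) : Set (Set (Models 𝒞 C)) :=
  range fun c' : C => {N | dist (t.realize N.1.reduct fun i => N.1.const (c i))
    (N.1.const c' : N.1.reduct) < ε}

theorem isOpen_of_mem_termRequirement {C : Type v} {k : ℕ} {t : Term L k} {c : Fin k → C} {ε : ℝ}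
    {V : Set (Models 𝒞 C)} (hV : V ∈ termRequirement 𝒞 t c ε) : IsOpen V := by
  obtain ⟨c', rfl⟩ := hV
  exact isOpen_lt (Models.continuous_dist_realize t (.var 0 : Term L 1) c fun _ => c')
    continuous_const

theorem dense_termRequirement {C : Type v} [Infinite C] {k : ℕ} (t : Term L k) (c : Fin k → C)
    {ε : ℝ} (hε : 0 < ε) {O : Set (Models 𝒞 C)} (hO : IsOpen O) (hne : O.Nonempty) :
    ∃ V ∈ termRequirement 𝒞 t c ε, (O ∩ V).Nonempty := by
  obtain ⟨N, hN⟩ := hne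
  obtain ⟨g, d, hgO, hc, hd⟩ := Models.exists_const_eq hO hN c
    fun _ : Fin 1 => t.realize N.1.reduct fun i => N.1.const (c i)
  refine ⟨_, mem_range_self (d 0), N.setConst g, hgO, ?_⟩
  change dist (t.realize N.1.reduct fun i => g (c i)) (g (d 0)) < ε
  rw [hd, funext hc]
  exact (dist_self _).trans_lt hε

/-- The requirement that one of the predicates `σ m` takes a value less than `s` at `c` and some
further tuple of constants. -/
def existsRequirement {C : Type v} {k : ℕ} {l : ℕ → ℕ} (σ : ∀ m, QFPredicate 𝒞 (k + l m))
    (c : Fin k → C) (s : ℝ) : Set (Set (Models 𝒞 C)) :=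
  range fun p : Σ m, Fin (l m) → C =>
    {N | (σ p.1).realize N.1.reduct (fun i => N.1.const (Fin.append c p.2 i)) < s}

theorem isOpen_of_mem_existsRequirement {C : Type v} {k : ℕ} {l : ℕ → ℕ}
    {σ : ∀ m, QFPredicate 𝒞 (k + l m)} {c : Fin k → C} {s : ℝ}
    {V : Set (Models 𝒞 C)} (hV : V ∈ existsRequirement σ c s) : IsOpen V := by
  obtain ⟨p, rfl⟩ := hV
  exact isOpen_lt ((σ p.1).continuous_realize_const _) continuous_const

theorem Models.exists_realize_append_lt {C : Type v} [Infinite C] {k l : ℕ}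
    (σ : QFPredicate 𝒞 (k + l)) (c : Fin k → C) {j : ℕ} (d : Fin j → C) {s : ℝ}
    {O : Set (Models 𝒞 C)} (hO : IsOpen O) {N : Models 𝒞 C} (hN : N ∈ O)
    (h : σ.infTail N.1.reduct (fun i => N.1.const (c i)) < (s : EReal)) :
    ∃ (g : C → N.1) (e : Fin l → C), N.setConst g ∈ O ∧ (∀ i, g (d i) = N.1.const (d i)) ∧
      σ.realize N.1.reduct (fun i => g (Fin.append c e i)) < s := by
  obtain ⟨y, hy⟩ := σ.infTail_lt_iff.1 h
  obtain ⟨g, e, hgO, hc, he⟩ := Models.exists_const_eq hO hN (Fin.append c d) y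
  refine ⟨g, e, hgO, fun i => by simpa using hc (Fin.natAdd k i), ?_⟩
  have hcc : (fun i => g (c i)) = fun i => N.1.const (c i) :=
    funext fun i => by simpa using hc (Fin.castAdd j i)
  rw [comp_append, hcc, funext he]
  exact hy

theorem dense_existsRequirement {C : Type v} [Infinite C] {k : ℕ} {l : ℕ → ℕ}
    (σ : ∀ m, QFPredicate 𝒞 (k + l m)) (c : Fin k → C) (s : ℝ) {O : Set (Models 𝒞 C)}
    (hO : IsOpen O)
    (h : ∃ N ∈ O, ⨅ m, (σ m).infTail N.1.reduct (fun i => N.1.const (c i)) < (s : EReal)) :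
    ∃ V ∈ existsRequirement σ c s, (O ∩ V).Nonempty := by
  obtain ⟨N, hN, hlt⟩ := h
  obtain ⟨m, hm⟩ := iInf_lt_iff.1 hlt
  -- No constants beyond `c` have to be preserved; the second `c` is a filler.
  obtain ⟨g, e, hgO, -, he⟩ := Models.exists_realize_append_lt (σ m) c c hO hN hm
  refine ⟨_, mem_range_self ⟨m, e⟩, N.setConst g, hgO, ?_⟩
  exact he

/-- The requirement that either `a` and `b` are not `δ`-close, or the infimum over constants of
`σ(a, y)` is at most `σ(b, d) + ε`. -/
def transferRequirement {C : Type v} {k l : ℕ} (σ : QFPredicate 𝒞 (k + l)) (a b : Fin k → C)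
    (d : Fin l → C) (δ ε : ℝ) : Set (Set (Models 𝒞 C)) :=
  insert {N | ∃ i, δ < dist (N.1.const (a i) : N.1.reduct) (N.1.const (b i))}
    (range fun e : Fin l → C =>
      {N | σ.realize N.1.reduct (fun i => N.1.const (Fin.append a e i)) <
        σ.realize N.1.reduct (fun i => N.1.const (Fin.append b d i)) + ε})

theorem isOpen_of_mem_transferRequirement {C : Type v} {k l : ℕ} {σ : QFPredicate 𝒞 (k + l)}
    {a b : Fin k → C} {d : Fin l → C} {δ ε : ℝ} {V : Set (Models 𝒞 C)}
    (hV : V ∈ transferRequirement σ a b d δ ε) : IsOpen V := by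
  obtain rfl | ⟨e, rfl⟩ := hV
  · have : {N : Models 𝒞 C | ∃ i, δ < dist (N.1.const (a i) : N.1.reduct) (N.1.const (b i))} =
        ⋃ i, {N | δ < dist (N.1.const (a i) : N.1.reduct) (N.1.const (b i))} := by
      ext N
      simp
    rw [this]
    exact isOpen_iUnion fun i => isOpen_lt continuous_const
      (Models.continuous_dist_realize (.var i : Term L k) (.var i : Term L k) a b)
  · exact isOpen_lt (σ.continuous_realize_const _)
      ((σ.continuous_realize_const _).add continuous_const)

theorem dense_transferRequirement {C : Type v} [Infinite C] {k l : ℕ} (σ : QFPredicate 𝒞 (k + l))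
    (a b : Fin k → C) (d : Fin l → C) {δ δ' ε ε' : ℝ} (hδ : δ < δ') (hε : ε' < ε)
    (hσ : ∀ M, 𝒞 M → ∀ x y : Fin k → M, (∀ i, dist (x i) (y i) < δ') →
      σ.infTail M x ≤ σ.infTail M y + (ε' : EReal))
    {O : Set (Models 𝒞 C)} (hO : IsOpen O) (hne : O.Nonempty) :
    ∃ V ∈ transferRequirement σ a b d δ ε, (O ∩ V).Nonempty := by
  obtain ⟨N, hN⟩ := hne
  -- The gap between `δ` and `δ'` lets two strict, hence open, alternatives cover every model.
  by_cases hab : ∀ i, dist (N.1.const (a i) : N.1.reduct) (N.1.const (b i)) < δ'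
  swap
  · push Not at hab
    obtain ⟨i, hi⟩ := hab
    exact ⟨_, mem_insert _ _, N, hN, i, hδ.trans_le hi⟩
  set s := σ.realize N.1.reduct (fun i => N.1.const (Fin.append b d i)) with hs
  have h1 : σ.infTail N.1.reduct (fun i => N.1.const (b i)) ≤ (s : EReal) := by
    rw [hs, comp_append]
    exact iInf_le _ _
  have h2 : σ.infTail N.1.reduct (fun i => N.1.const (a i)) < ((s + ε : ℝ) : EReal) := by
    refine ((hσ _ N.2 _ _ hab).trans (add_le_add_left h1 _)).trans_lt ?_
    rw [← EReal.coe_add, EReal.coe_lt_coe_iff]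
    linarith
  obtain ⟨g, e, hgO, hbd, he⟩ :=
    Models.exists_realize_append_lt σ a (Fin.append b d) hO hN h2
  refine ⟨_, mem_insert_of_mem _ (mem_range_self e), N.setConst g, hgO, ?_⟩
  change σ.realize N.1.reduct (fun i => g (Fin.append a e i)) <
    σ.realize N.1.reduct (fun i => g (Fin.append b d i)) + ε
  rw [funext hbd]
  exact he

/-- A sequence of models with constants is generic for a countable family of infinitary
sentences, if every requirement relevant to the sentences is eventually met. -/
structure IsGeneric {C : Type v} {ι : Type*} (φ : ι → SupInfSentence 𝒞) (r : ι → ℝ)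
    (N : ℕ → Models 𝒞 C) : Prop where
  term : ∀ {k} (t : Term L k) (c : Fin k → C) (ε : ℝ), 0 < ε → ∃ c',
    ∀ᶠ j in atTop, dist (t.realize (N j).1.reduct fun i => (N j).1.const (c i))
      ((N j).1.const c' : (N j).1.reduct) < ε
  exists_lt : ∀ n (c : Fin (φ n).arity → C) (ε : ℝ), 0 < ε → ∃ m, ∃ d : Fin _ → C,
    ∀ᶠ j in atTop, ((φ n).matrix m).realize (N j).1.reduct
      (fun i => (N j).1.const (Fin.append c d i)) < r n + ε
  transfer : ∀ n (ε : ℝ), 0 < ε → ∃ δ : ℝ, 0 < δ ∧ ∀ m (a b : Fin (φ n).arity → C) (d : Fin _ → C),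
    (∀ᶠ j in atTop, ∃ i, δ < dist ((N j).1.const (a i) : (N j).1.reduct) ((N j).1.const (b i))) ∨
    ∃ e : Fin _ → C, ∀ᶠ j in atTop, ((φ n).matrix m).realize (N j).1.reduct
      (fun i => (N j).1.const (Fin.append a e i)) <
        ((φ n).matrix m).realize (N j).1.reduct (fun i => (N j).1.const (Fin.append b d i)) + ε

theorem exists_isGeneric {C : Type v} [Countable C] [Infinite C] {ι : Type*} [Countable ι]
    (h_nonempty : ∃ M, 𝒞 M) (h_separable : IsSeparableFor L 𝒞)
    (φ : ι → SupInfSentence 𝒞) (r : ι → ℝ)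
    (h_consistent : ∀ q : Set (OpenCondition (L.withConstants C)), IsForcingCondition 𝒞 q →
      ∀ (n : ι) (ε : ℝ), 0 < ε → ∀ c : Fin (φ n).arity → C,
        ∃ N : MetricStructure.{v, w, u} (L.withConstants C),
          𝒞 N.reduct ∧ (∀ o ∈ q, o.Holds N) ∧
          (φ n).disjunction N.reduct (fun i => N.const (c i)) < ((r n + ε : ℝ) : EReal)) :
    ∃ N : ℕ → Models 𝒞 C, IsGeneric φ r N := by
  have : Nonempty (Models 𝒞 C) := by
    obtain ⟨M, hM⟩ := h_nonempty
    exact ⟨⟨M.expand fun _ => Classical.arbitrary M, hM⟩⟩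
  -- There may be uncountably many terms, so requirements are imposed only for these; the others
  -- follow by approximation.
  choose T hT hTdense using h_separable.exists_countable_dense_terms
  have hT' : ∀ k, Countable (T k) := fun k => (hT k).to_subtype
  have hpos : ∀ j : ℕ, 0 < (1 / (j + 1) : ℝ) := fun j => Nat.one_div_pos_of_nat
  -- Equicontinuity is taken at half the accuracy, which leaves room for the strict inequality in
  -- the transfer requirement.
  choose δ hδ hφ using fun n j => (φ n).equicontinuous _ (half_pos (hpos j))
  let R₁ : (Σ k, T k × (Fin k → C) × ℕ) → Set (Set (Models 𝒞 C)) := fun p =>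
    termRequirement 𝒞 p.2.1.1 p.2.2.1 (1 / (p.2.2.2 + 1))
  let R₂ : (Σ n, (Fin (φ n).arity → C) × ℕ) → Set (Set (Models 𝒞 C)) := fun p =>
    existsRequirement (φ p.1).matrix p.2.1 (r p.1 + 1 / (p.2.2 + 1))
  let R₃ : (Σ (n : ι) (m : ℕ), (Fin (φ n).arity → C) × (Fin (φ n).arity → C) ×
      (Fin ((φ n).innerArity m) → C) × ℕ) → Set (Set (Models 𝒞 C)) := fun p =>
    transferRequirement ((φ p.1).matrix p.2.1) p.2.2.1 p.2.2.2.1 p.2.2.2.2.1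
      (δ p.1 p.2.2.2.2.2 / 2) (1 / (p.2.2.2.2.2 + 1))
  obtain ⟨N, hN⟩ := exists_generic_sequence (𝓡 := range R₁ ∪ (range R₂ ∪ range R₃))
    ((countable_range _).union ((countable_range _).union (countable_range _)))
    (by
      rintro _ (⟨p, rfl⟩ | ⟨p, rfl⟩ | ⟨p, rfl⟩) V hV
      · exact isOpen_of_mem_termRequirement hV
      · exact isOpen_of_mem_existsRequirement hV
      · exact isOpen_of_mem_transferRequirement hV)
    (by
      rintro _ (⟨⟨k, t, c, j⟩, rfl⟩ | ⟨⟨n, c, j⟩, rfl⟩ | ⟨⟨n, m, a, b, d, j⟩, rfl⟩) O hO hne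
      · exact dense_termRequirement t.1 c (hpos j) hO hne
      · refine dense_existsRequirement _ _ _ hO ?_
        obtain ⟨N, hN⟩ := hne
        obtain ⟨q, hq, hqO⟩ := Models.exists_isForcingCondition hO hN
        obtain ⟨N', hN', hholds, hlt⟩ := h_consistent q hq n _ (hpos j) c
        exact ⟨⟨N', hN'⟩, hqO _ hholds, hlt⟩
      · exact dense_transferRequirement _ a b d (half_lt_self (hδ n j)) (half_lt_self (hpos j))
          (hφ n j m) hO hne)
  refine ⟨N, fun {k} t c ε hε => ?_, fun n c ε hε => ?_, fun n ε hε => ?_⟩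
  · obtain ⟨j, hj⟩ := exists_nat_one_div_lt (half_pos hε)
    obtain ⟨t', ht', htt'⟩ := hTdense k t (ε / 2) (half_pos hε)
    obtain ⟨_, ⟨c', rfl⟩, hev⟩ := hN (R₁ ⟨k, ⟨t', ht'⟩, c, j⟩) (Or.inl (mem_range_self _))
    refine ⟨c', hev.mono fun i hi => ?_⟩
    have h1 := htt' _ (N i).2 fun l => (N i).1.const (c l)
    have h2 : dist (t'.realize (N i).1.reduct fun l => (N i).1.const (c l))
      ((N i).1.const c' : (N i).1.reduct) < 1 / (j + 1) := hi
    refine (dist_triangle _ _ _).trans_lt ((add_lt_add_of_le_of_lt h1 (h2.trans hj)).trans_eq ?_)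
    ring
  · obtain ⟨j, hj⟩ := exists_nat_one_div_lt hε
    obtain ⟨_, ⟨⟨m, d⟩, rfl⟩, hev⟩ := hN (R₂ ⟨n, c, j⟩) (Or.inr (Or.inl (mem_range_self _)))
    refine ⟨m, d, hev.mono fun i hi => ?_⟩
    exact lt_trans hi (add_lt_add_right hj _)
  · obtain ⟨j, hj⟩ := exists_nat_one_div_lt hε
    refine ⟨δ n j / 2, half_pos (hδ n j), fun m a b d => ?_⟩
    obtain ⟨_, rfl | ⟨e, rfl⟩, hev⟩ :=
      hN (R₃ ⟨n, m, a, b, d, j⟩) (Or.inr (Or.inr (mem_range_self _)))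
    · exact Or.inl hev
    · exact Or.inr ⟨e, hev.mono fun i hi => lt_trans hi (add_lt_add_right hj _)⟩

/-! ### Limit models. -/

/-- A structure `M` in which the family `g` is dense, and in which the values of quantifier-free
formulas at `g` are the limits along `U` of their values in the models `N j`. -/
structure IsLimitModel {C : Type v} (N : ℕ → Models 𝒞 C) (U : Ultrafilter ℕ)
    (M : MetricStructure.{v, w, u} L) (g : C → M) : Prop where
  denseRange : DenseRange g
  tendsto : ∀ {k : ℕ} {φ : Formula L k}, φ.IsQuantifierFree → ∀ c : Fin k → C,
    Tendsto (fun j => φ.realize (N j).1.reduct fun i => (N j).1.const (c i)) U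
      (𝓝 (φ.realize M fun i => g (c i)))

namespace IsLimitModel

variable {C : Type v} {N : ℕ → Models 𝒞 C} {U : Ultrafilter ℕ} {M : MetricStructure.{v, w, u} L}
  {g : C → M}

theorem tendsto_dist (h : IsLimitModel N U M g) (a b : C) :
    Tendsto (fun j => dist ((N j).1.const a : (N j).1.reduct) ((N j).1.const b)) U
      (𝓝 (dist (g a) (g b))) :=
  h.tendsto (.dist (.var 0 : Term L 2) (.var 1)) ![a, b]

theorem interpretableIn (h : IsLimitModel N U M g) {k : ℕ} (σ : QFPredicate 𝒞 k) :
    σ.InterpretableIn M := by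
  refine Metric.uniformCauchySeqOn_iff.2 fun ε hε => ?_
  obtain ⟨n, hn⟩ := σ.cauchy (ε / 2) (half_pos hε)
  refine ⟨n, fun i hi j hj a _ => lt_of_le_of_lt ?_ (half_lt_self hε)⟩
  have hcont : ∀ i, Continuous fun a : Fin k → M => (σ.approx i).realize M a := fun i =>
    ((σ.isQuantifierFree i).uniformContinuous M).continuous
  refine (DenseRange.piMap fun _ : Fin k => h.denseRange).induction_on
    (p := fun a => dist ((σ.approx i).realize M a) ((σ.approx j).realize M a) ≤ ε / 2) a
    (isClosed_le ((hcont i).dist (hcont j)) continuous_const) fun c => ?_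
  exact le_of_tendsto' ((h.tendsto (σ.isQuantifierFree i) c).dist
    (h.tendsto (σ.isQuantifierFree j) c)) fun l => hn i hi j hj _ (N l).2 _

theorem tendsto_predicate (h : IsLimitModel N U M g) {k : ℕ} (σ : QFPredicate 𝒞 k)
    (c : Fin k → C) :
    Tendsto (fun j => σ.realize (N j).1.reduct fun i => (N j).1.const (c i)) U
      (𝓝 (σ.realize M fun i => g (c i))) :=
  ((σ.tendstoUniformly_const c).comp N).tendsto_of_eventually_tendsto
    (Eventually.of_forall fun i => h.tendsto (σ.isQuantifierFree i) c)
    ((h.interpretableIn σ).tendsto _)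

end IsLimitModel

theorem IsGeneric.exists_isLimitModel {C : Type v} [Nonempty C] {ι : Type*}
    {φ : ι → SupInfSentence 𝒞} {r : ι → ℝ} {N : ℕ → Models 𝒞 C} (hN : IsGeneric φ r N)
    {U : Ultrafilter ℕ} (hU : (U : Filter ℕ) ≤ atTop) :
    ∃ (M : MetricStructure.{v, w, u} L) (g : C → M), IsLimitModel N U M g := by
  obtain ⟨M, g, hg, hlim⟩ := exists_denseRange_ultralimit (N := fun j => (N j).1.reduct) (U := U)
    (fun c j => (N j).1.const c) fun f c ε hε => by
      -- A function symbol applied to distinct variables is the only kind of term needed.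
      obtain ⟨c', hc'⟩ := hN.term (.app f .var) c ε hε
      exact ⟨c', hU (hc'.mono fun j hj => hj.le)⟩
  exact ⟨M, g, hg, hlim⟩

/-- Approximating `x` by constants `c` yields an index `m`, but the modulus of `σ_m` depends on `m`,
so `c` may be too far from `x` for it. A second, finer approximation `c'` is then taken, and the
witness is moved from `c` to `c'` by transfer, whose `δ` does not depend on `m`. -/
theorem IsLimitModel.satisfies {C : Type v} {ι : Type*} {φ : ι → SupInfSentence 𝒞} {r : ι → ℝ}
    {N : ℕ → Models 𝒞 C} (hN : IsGeneric φ r N) {U : Ultrafilter ℕ} (hU : (U : Filter ℕ) ≤ atTop)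
    {M : MetricStructure.{v, w, u} L} {g : C → M} (h : IsLimitModel N U M g) (n : ι) :
    (φ n).Satisfies (r n) M := by
  refine ⟨fun m => h.interpretableIn _, iSup_le fun x => ?_⟩
  refine EReal.le_of_forall_lt_iff_le.1 fun s hs => ?_
  rw [EReal.coe_lt_coe_iff] at hs
  -- One `ε` each for the witness at `c`, the transfer to `c'`, and the passage from `c'` to `x`.
  set ε := (s - r n) / 3 with hε
  have hε0 : 0 < ε := by rw [hε]; linarith
  have hdense : ∀ η : ℝ, 0 < η → ∃ c : Fin (φ n).arity → C, ∀ i, dist (x i) (g (c i)) < η := by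
    intro η hη
    choose c hc using fun i => h.denseRange.exists_dist_lt (x i) hη
    exact ⟨c, hc⟩
  obtain ⟨δ, hδ, htrans⟩ := hN.transfer n ε hε0
  obtain ⟨c, hc⟩ := hdense (δ / 2) (half_pos hδ)
  obtain ⟨m, d, hd⟩ := hN.exists_lt n c ε hε0
  set σ := (φ n).matrix m
  have h1 : σ.realize M (fun i => g (Fin.append c d i)) ≤ r n + ε :=
    le_of_tendsto (h.tendsto_predicate σ _) (hU (hd.mono fun j hj => hj.le))
  obtain ⟨η, hη, hunif⟩ := Metric.uniformContinuous_iff.1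
    (h.interpretableIn σ).uniformContinuous ε hε0
  obtain ⟨c', hc'⟩ := hdense (min (δ / 2) η) (lt_min (half_pos hδ) hη)
  have hcc' : ∀ i, dist (g (c' i)) (g (c i)) < δ := fun i =>
    (dist_triangle_left _ _ (x i)).trans_lt
      ((add_lt_add ((hc' i).trans_le (min_le_left _ _)) (hc i)).trans_eq (add_halves δ))
  obtain ⟨e, he⟩ : ∃ e : Fin _ → C, σ.realize M (fun i => g (Fin.append c' e i)) ≤
      σ.realize M (fun i => g (Fin.append c d i)) + ε := by
    obtain hfar | ⟨e, he⟩ := htrans m c' c d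
    -- The far alternative would hold eventually, whereas `c'` and `c` are `δ`-close in `M`, hence
    -- in `U`-almost every model.
    · have hnear : ∀ᶠ j in (U : Filter ℕ), ∀ i,
          dist ((N j).1.const (c' i) : (N j).1.reduct) ((N j).1.const (c i)) < δ :=
        eventually_all.2 fun i => (h.tendsto_dist (c' i) (c i)).eventually_lt_const (hcc' i)
      obtain ⟨j, ⟨i, hi⟩, hj⟩ := ((hfar.filter_mono hU).and hnear).exists
      exact absurd (hj i) hi.le.not_gt
    · exact ⟨e, le_of_tendsto_of_tendsto (h.tendsto_predicate σ _)
        ((h.tendsto_predicate σ _).add_const ε) (hU (he.mono fun j hj => hj.le))⟩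
  have h2 : dist (Fin.append x fun i => g (e i)) (fun i => g (Fin.append c' e i)) < η := by
    rw [comp_append, dist_pi_lt_iff hη]
    refine Fin.addCases (fun i => ?_) fun i => ?_
    · simpa using (hc' i).trans_le (min_le_right _ _)
    · simpa using hη
  have h3 := (abs_lt.1 (hunif h2)).2
  refine (iInf_le _ m).trans ((iInf_le _ fun i => g (e i)).trans ?_)
  rw [EReal.coe_le_coe_iff]
  change σ.realize M (Fin.append x fun i => g (e i)) ≤ s
  linarith

end ContinuousLogic

theorem theorem6p1 {L : ContinuousLogic.MetricLanguage.{v, w}}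
    (𝒞 : ContinuousLogic.MetricStructure.{v, w, u} L → Prop)
    (h_elementary : ContinuousLogic.IsElementary 𝒞)
    (h_nonempty : ∃ M, 𝒞 M)
    (h_separable : ContinuousLogic.IsSeparableFor L 𝒞)
    (C : Type v) [Countable C] [Infinite C]
    {ι : Type*} [Countable ι]
    (φ : ι → ContinuousLogic.SupInfSentence 𝒞) (r : ι → ℝ)
    (P : ContinuousLogic.MetricStructure.{v, w, u} L → Prop)
    (hP : ContinuousLogic.IsAxiomatizedBy P φ r)
    (h_consistent : ∀ q : Set (ContinuousLogic.OpenCondition (L.withConstants C)),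
      ContinuousLogic.IsForcingCondition 𝒞 q →
      ∀ (n : ι) (ε : ℝ), 0 < ε → ∀ c : Fin (φ n).arity → C,
        ∃ N : ContinuousLogic.MetricStructure.{v, w, u} (L.withConstants C),
          𝒞 N.reduct ∧ (∀ o ∈ q, o.Holds N) ∧
          (φ n).disjunction N.reduct (fun i => N.const (c i)) < ((r n + ε : ℝ) : EReal)) :
    ∃ M : ContinuousLogic.MetricStructure.{v, w, u} L,
      TopologicalSpace.SeparableSpace M ∧ P M := by
  obtain ⟨N, hN⟩ := ContinuousLogic.exists_isGeneric h_nonempty h_separable φ r h_consistent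
  have hU : (hyperfilter ℕ : Filter ℕ) ≤ atTop := Nat.cofinite_eq_atTop ▸ hyperfilter_le_cofinite
  obtain ⟨M, g, hM⟩ := hN.exists_isLimitModel hU
  exact ⟨M, ⟨range g, countable_range g, hM.denseRange⟩, (hP M).2 fun n => hM.satisfies hN hU n⟩
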